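/- Let $E$ be a finite set with the discrete topology, let $\Sigma=E^{\mathbb Z}$ carry the product topology, with Borel $\sigma$-algebra $\mathcal B(\Sigma)$, and let $S:\Sigma\to\Sigma$, $(S\sigma)_i=\sigma_{i+1}$, be the left shift. For $m\le 0$ let $\mathcal A_m$ be the $\sigma$-algebra on $\Sigma$ generated by the cylinder sets over finitely many coordinates with indices $\ge m$. Let $\phi_0$ be a probability measure on $\mathcal A_0$. For $Q\subset\Sigma$ let $\mathcal C(Q)$ be the set of all families $(A_m)_{m\le 0}$ with $A_m\in\mathcal A_m$ for all $m\le 0$ and $Q\subset\bigcup_{m\le 0}A_m$, and put $$\Phi(Q)=\inf_{(A_m)_{m\le 0}\in\mathcal C(Q)}\ \sum_{m\le 0}\phi_0(S^mA_m).$$ This is an outer measure on $\Sigma$ (the dynamically defined outer measure resulting from $\phi_0$), and its restriction to $\mathcal B(\Sigma)$ is a measure. Let $\Lambda$ be an $S$-invariant Borel probability measure on $\Sigma$ whose restriction to $\mathcal A_0$ is absolutely continuous with respect to $\phi_0$, let $Z$ be any $\mathcal A_0$-measurable version of the Radon–Nikodym derivative $d(\Lambda|_{\mathcal A_0})/d\phi_0$,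 and set $$Z^*=\sup_{m\le 0}Z\circ S^m,\qquad K^*(\Lambda|\phi_0)=\int\log Z^*\,d\Lambda$$ (the negative part of $\log Z^*$ is $\Lambda$-integrable, so the integral is well defined in $(-\infty,\infty]$). For Borel probability measures $\mu,\nu$ let $K(\mu|\nu)$ denote the Kullback–Leibler divergence, $K(\mu|\nu)=\int\log\frac{d\mu}{d\nu}\,d\mu$ if $\mu\ll\nu$, and $K(\mu|\nu)=\infty$ otherwise. Suppose that $K^*(\Lambda|\phi_0)<\infty$. Then: (i) For every $Q\in\mathcal B(\Sigma)$ with $\Lambda(Q)>0$, $$\Phi(Q)\ \ge\ \Lambda(Q)\,\exp\Bigl(-\frac1{\Lambda(Q)}\int_Q\log Z^*\,d\Lambda\Bigr).$$ (ii) $\Phi(\Sigma)>0$ and, with $\hat\Phi=\Phi/\Phi(\Sigma)$ on $\mathcal B(\Sigma)$, $$\Phi(\Sigma)\ \ge\ \exp\bigl(K(\Lambda|\hat\Phi)-K^*(\Lambda|\phi_0)\bigr);$$ in particular $K(\Lambda|\hat\Phi)\le K^*(\Lambda|\phi_0)$. -/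

import Mathlib

open MeasureTheory Set
open scoped ENNReal

namespace DynDefMeasure

section Defs

variable {E : Type*}

/-- The `m`-th iterate `S ^ m` (`m ∈ ℤ`) of the left shift `S = shift 1` on `Σ = E^ℤ`,
`(S σ) i = σ (i + 1)`. -/
def shift (m : ℤ) (σ : ℤ → E) : ℤ → E := fun i => σ (i + m)

theorem shift_zero (σ : ℤ → E) : shift 0 σ = σ := by
  funext i; simp [shift]

theorem shift_shift (m n : ℤ) (σ : ℤ → E) : shift m (shift n σ) = shift (m + n) σ := by
  funext i; simp [shift, add_assoc]

theorem shift_image (m : ℤ) (A : Set (ℤ → E)) : shift m '' A = shift (-m) ⁻¹' A := by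
  ext σ
  constructor
  · rintro ⟨τ, hτ, rfl⟩
    simpa [shift_shift, shift_zero] using hτ
  · intro h
    exact ⟨shift (-m) σ, h, by simp [shift_shift, shift_zero]⟩

variable [MeasurableSpace E]

/-- The σ-algebra `𝒜_m` on `Σ = E^ℤ` generated by the cylinder sets over coordinates `≥ m`, that
is, by the coordinate maps `σ ↦ σ i`, `i ≥ m`. -/
@[reducible] def coordAlg (E : Type*) [MeasurableSpace E] (m : ℤ) : MeasurableSpace (ℤ → E) :=
  ⨆ i : ℤ, ⨆ _ : m ≤ i, MeasurableSpace.comap (fun σ : ℤ → E => σ i) inferInstance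

theorem coordAlg_le (m : ℤ) : coordAlg E m ≤ (inferInstance : MeasurableSpace (ℤ → E)) :=
  iSup_le fun i => iSup_le fun _ => (measurable_pi_apply i).comap_le

theorem coordAlg_anti {m n : ℤ} (h : m ≤ n) : coordAlg E n ≤ coordAlg E m :=
  iSup_le fun i => iSup_le fun hi =>
    le_iSup₂_of_le (f := fun (i : ℤ) (_ : m ≤ i) =>
      MeasurableSpace.comap (fun σ : ℤ → E => σ i) inferInstance) i (h.trans hi) le_rfl

theorem measurableSet_shift_image {m : ℤ} (k : ℤ) {A : Set (ℤ → E)}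
    (hA : MeasurableSet[coordAlg E m] A) : MeasurableSet[coordAlg E (m - k)] (shift k '' A) := by
  rw [shift_image]
  have : Measurable[coordAlg E (m - k), coordAlg E m] (shift (-k) : (ℤ → E) → (ℤ → E)) := by
    rw [measurable_iff_comap_le, coordAlg, MeasurableSpace.comap_iSup]
    refine iSup_le fun i => ?_
    rw [MeasurableSpace.comap_iSup]
    refine iSup_le fun hi => ?_
    rw [MeasurableSpace.comap_comp]
    exact le_iSup₂_of_le (f := fun (i : ℤ) (_ : m - k ≤ i) =>
      MeasurableSpace.comap (fun σ : ℤ → E => σ i) inferInstance) (i + -k) (by omega) le_rfl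
  exact this hA

/-- `𝒞(Q)`: the families `(A_m)_{m ≤ 0}` with `A_m ∈ 𝒜_m` and `Q ⊆ ⋃_{m ≤ 0} A_m`. The index
`m ≤ 0` is written `m = -n`, `n ∈ ℕ`. -/
def covers (Q : Set (ℤ → E)) : Set (ℕ → Set (ℤ → E)) :=
  {A | (∀ n : ℕ, MeasurableSet[coordAlg E (-n)] (A n)) ∧ Q ⊆ ⋃ n, A n}

/-- `∑_{m ≤ 0} φ₀ (S^m A_m)`. -/
noncomputable def coverSum (φ₀ : Measure[coordAlg E 0] (ℤ → E)) (A : ℕ → Set (ℤ → E)) : ℝ≥0∞ :=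
  ∑' n : ℕ, φ₀ (shift (-n) '' A n)

theorem measurableSet_cover {A : Set (ℤ → E)} (n : ℕ) (hA : MeasurableSet[coordAlg E (-n)] A) :
    MeasurableSet[coordAlg E 0] (shift (-n) '' A) := by
  have := measurableSet_shift_image (-(n : ℤ)) hA
  rwa [sub_self] at this

/-- The dynamically defined outer measure `Φ` resulting from `φ₀`. -/
noncomputable def ddOuter (φ₀ : Measure[coordAlg E 0] (ℤ → E)) : OuterMeasure (ℤ → E) where
  measureOf Q := ⨅ A ∈ covers Q, coverSum φ₀ A
  empty := by
    refine le_antisymm (iInf₂_le_of_le (fun _ => ∅) ⟨fun _ => ?_, by simp⟩ ?_) zero_le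
    · exact @MeasurableSet.empty _ (coordAlg E _)
    · simp [coverSum]
  mono := fun {Q R} h => by
    refine le_iInf₂ fun A hA => iInf₂_le A ⟨hA.1, h.trans hA.2⟩
  iUnion_nat := fun Q _ => by
    refine ENNReal.le_of_forall_pos_le_add fun ε hε hb => ?_
    rcases ENNReal.exists_pos_sum_of_countable (ENNReal.coe_pos.2 hε).ne' ℕ with ⟨δ, hδ, hl⟩
    have key : ∀ i, ∃ A ∈ covers (Q i),
        coverSum φ₀ A < (⨅ A ∈ covers (Q i), coverSum φ₀ A) + δ i := by
      intro i
      have h : (⨅ A ∈ covers (Q i), coverSum φ₀ A)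
          < (⨅ A ∈ covers (Q i), coverSum φ₀ A) + δ i :=
        ENNReal.lt_add_right (ne_top_of_le_ne_top hb.ne <|
          ENNReal.le_tsum (f := fun i => ⨅ A ∈ covers (Q i), coverSum φ₀ A) i)
          (by simpa using (hδ i).ne')
      obtain ⟨A, hA⟩ := iInf_lt_iff.mp h
      obtain ⟨hA, h'⟩ := iInf_lt_iff.mp hA
      exact ⟨A, hA, h'⟩
    choose A hA hlt using key
    have hmem : (fun n => ⋃ i, A i n) ∈ covers (⋃ i, Q i) := by
      refine ⟨fun n => @MeasurableSet.iUnion _ _ (coordAlg E _) _ _ fun i => (hA i).1 n, ?_⟩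
      refine iUnion_subset fun i => (hA i).2.trans (iUnion_mono fun n => ?_)
      exact subset_iUnion (fun i => A i n) i
    refine (iInf₂_le _ hmem).trans ?_
    calc coverSum φ₀ (fun n => ⋃ i, A i n)
          ≤ ∑' n : ℕ, ∑' i : ℕ, φ₀ (shift (-n) '' A i n) := by
            refine ENNReal.tsum_le_tsum fun n => ?_
            rw [image_iUnion]
            exact measure_iUnion_le _
        _ = ∑' i : ℕ, coverSum φ₀ (A i) := ENNReal.tsum_comm
        _ ≤ ∑' i : ℕ, ((⨅ A ∈ covers (Q i), coverSum φ₀ A) + δ i) :=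
            ENNReal.tsum_le_tsum fun i => (hlt i).le
        _ ≤ _ := by
            rw [ENNReal.tsum_add]
            gcongr

theorem ddOuter_apply (φ₀ : Measure[coordAlg E 0] (ℤ → E)) (Q : Set (ℤ → E)) :
    ddOuter φ₀ Q = ⨅ A ∈ covers Q, coverSum φ₀ A := rfl

theorem ddOuter_le (φ₀ : Measure[coordAlg E 0] (ℤ → E)) {A : Set (ℤ → E)} (n : ℕ)
    (hA : MeasurableSet[coordAlg E (-n)] A) : ddOuter φ₀ A ≤ φ₀ (shift (-n) '' A) := by
  rw [ddOuter_apply]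
  have hmem : (fun k => if k = n then A else ∅) ∈ covers A := by
    refine ⟨fun k => ?_, fun σ hσ => mem_iUnion.2 ⟨n, by simpa using hσ⟩⟩
    by_cases h : k = n
    · subst h; simpa using hA
    · simp only [h, if_false]
      exact @MeasurableSet.empty _ (coordAlg E _)
  refine (iInf₂_le _ hmem).trans ?_
  rw [coverSum, tsum_eq_single n]
  · simp
  · intro k hk; simp [hk]

/-- Sets of `𝒜_0` are Carathéodory measurable. -/
theorem isCaratheodory_zero (φ₀ : Measure[coordAlg E 0] (ℤ → E)) {B : Set (ℤ → E)}
    (hB : MeasurableSet[coordAlg E 0] B) : (ddOuter φ₀).IsCaratheodory B := by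
  rw [OuterMeasure.isCaratheodory_iff_le']
  intro Q
  rw [ddOuter_apply φ₀ Q]
  refine le_iInf₂ fun A hA => ?_
  have hBn : ∀ n : ℕ, MeasurableSet[coordAlg E (-n)] B := fun n =>
    coordAlg_anti (E := E) (by omega : -(n : ℤ) ≤ 0) _ hB
  have h1 : ddOuter φ₀ (Q ∩ B) ≤ coverSum φ₀ (fun n => A n ∩ B) :=
    iInf₂_le _ ⟨fun n => @MeasurableSet.inter _ (coordAlg E _) _ _ (hA.1 n) (hBn n), by
      rw [← iUnion_inter]; exact inter_subset_inter_left _ hA.2⟩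
  have h2 : ddOuter φ₀ (Q \ B) ≤ coverSum φ₀ (fun n => A n \ B) :=
    iInf₂_le _ ⟨fun n => @MeasurableSet.diff _ (coordAlg E _) _ _ (hA.1 n) (hBn n), by
      rw [← iUnion_sdiff]; exact sdiff_subset_sdiff_left hA.2⟩
  refine (add_le_add h1 h2).trans (le_of_eq ?_)
  rw [coverSum, coverSum, ← ENNReal.tsum_add, coverSum]
  refine tsum_congr fun n => ?_
  simp only [shift_image, preimage_inter, preimage_sdiff]
  refine measure_inter_add_sdiff _ ?_
  rw [← shift_image]
  exact measurableSet_cover n (hBn n)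

theorem ddOuter_le_preimage (φ₀ : Measure[coordAlg E 0] (ℤ → E)) (k : ℕ) (Q : Set (ℤ → E)) :
    ddOuter φ₀ Q ≤ ddOuter φ₀ (shift k ⁻¹' Q) := by
  rw [ddOuter_apply φ₀ (shift k ⁻¹' Q)]
  refine le_iInf₂ fun A hA => ?_
  have hsub : Q ⊆ ⋃ n, shift k '' A n := by
    rw [← image_iUnion, shift_image]
    intro σ hσ
    refine hA.2 ?_
    simpa [shift_shift, shift_zero] using hσ
  refine (measure_mono hsub).trans ((measure_iUnion_le _).trans ?_)
  refine ENNReal.tsum_le_tsum fun n => ?_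
  have hm : MeasurableSet[coordAlg E (-(n + k : ℕ))] (shift k '' A n) := by
    have := measurableSet_shift_image (k : ℤ) (hA.1 n)
    convert this using 2
    push_cast; ring
  refine (ddOuter_le φ₀ (n + k) hm).trans (le_of_eq ?_)
  rw [← image_comp]
  congr 2
  funext σ
  simp [shift_shift]

/-- Measurable subsets of `Σ` are Carathéodory measurable for `Φ`, so that the restriction of `Φ` to
the Borel σ-algebra is a measure. -/
theorem le_caratheodory (φ₀ : Measure[coordAlg E 0] (ℤ → E)) [IsFiniteMeasure φ₀] :
    (inferInstance : MeasurableSpace (ℤ → E)) ≤ (ddOuter φ₀).caratheodory := by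
  set Φ := ddOuter φ₀ with hΦ
  -- `Ψ` is the supremum of the outer measures `Q ↦ Φ (S^{-k} Q)`
  let Ψ : OuterMeasure (ℤ → E) := ⨆ k : ℕ, OuterMeasure.map (shift k) Φ
  have hΨ : ∀ Q, Ψ Q = ⨆ k : ℕ, Φ (shift k ⁻¹' Q) := fun Q => by
    simp [Ψ, OuterMeasure.iSup_apply]
  have hmono : ∀ Q : Set (ℤ → E), Monotone fun k : ℕ => Φ (shift k ⁻¹' Q) := by
    intro Q
    refine monotone_nat_of_le_succ fun k => ?_
    refine (ddOuter_le_preimage φ₀ 1 _).trans (le_of_eq ?_)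
    rw [hΦ]
    congr 1
    ext σ
    simp [shift_shift]
  have hΨcar : (inferInstance : MeasurableSpace (ℤ → E)) ≤ Ψ.caratheodory := by
    have hi : ∀ (i : ℤ), MeasurableSpace.comap (fun σ : ℤ → E => σ i) inferInstance
        ≤ Ψ.caratheodory := by
      rintro i _ ⟨C, hC, rfl⟩
      rw [OuterMeasure.isCaratheodory_iff_le]
      intro Q
      have hB : ∀ k : ℕ, -i ≤ k →
          MeasurableSet[coordAlg E 0] (shift k ⁻¹' ((fun σ : ℤ → E => σ i) ⁻¹' C)) := by
        intro k hk
        refine (le_iSup₂_of_le (f := fun (i : ℤ) (_ : 0 ≤ i) =>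
          MeasurableSpace.comap (fun σ : ℤ → E => σ i) inferInstance) (i + k) (by omega) le_rfl) _ ?_
        exact ⟨C, hC, rfl⟩
      rw [hΨ, hΨ, ENNReal.iSup_add_iSup_of_monotone (hmono _) (hmono _)]
      refine iSup_le fun k => ?_
      let l := max k (-i).toNat
      refine (add_le_add (hmono _ (le_max_left k (-i).toNat))
        (hmono _ (le_max_left k (-i).toNat))).trans ?_
      refine le_trans (le_of_eq ?_) ((hΨ Q).symm ▸ le_iSup (fun k : ℕ => Φ (shift k ⁻¹' Q)) l)
      exact (isCaratheodory_zero φ₀ (hB l (by omega)) _).symm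
    exact iSup_le hi
  have hle : ∀ Q, Φ Q ≤ Ψ Q := fun Q => by
    rw [hΨ]
    refine le_trans (le_of_eq ?_) (le_iSup (fun k : ℕ => Φ (shift k ⁻¹' Q)) 0)
    congr 1
    ext σ
    simp [shift_zero]
  have huniv : Ψ univ = Φ univ := by rw [hΨ]; simp
  have hfin : Φ univ ≠ ∞ := by
    refine ne_top_of_le_ne_top (measure_ne_top φ₀ _) (ddOuter_le φ₀ 0 ?_)
    exact @MeasurableSet.univ _ (coordAlg E _)
  have heq : ∀ B : Set (ℤ → E), MeasurableSet B → Ψ B = Φ B := by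
    intro B hB
    refine le_antisymm ?_ (hle B)
    have h1 : Ψ B + Ψ Bᶜ ≤ Φ B + Ψ Bᶜ := by
      have := (Ψ.isCaratheodory_iff.1 (hΨcar _ hB)) univ
      rw [univ_inter, ← compl_eq_univ_sdiff, huniv] at this
      rw [← this]
      calc Φ univ ≤ Φ B + Φ Bᶜ := by
            rw [← union_compl_self B]; exact measure_union_le _ _
        _ ≤ _ := add_le_add le_rfl (hle _)
    refine (ENNReal.add_le_add_iff_right ?_).1 h1
    exact ne_top_of_le_ne_top (huniv ▸ hfin) (measure_mono (subset_univ _))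
  intro B hB
  rw [OuterMeasure.isCaratheodory_iff_le]
  intro Q
  rw [hΦ, ddOuter_apply φ₀ Q, ← hΦ]
  refine le_iInf₂ fun A hA => ?_
  have hU : MeasurableSet (⋃ n, A n) := MeasurableSet.iUnion fun n => coordAlg_le _ _ (hA.1 n)
  calc Φ (Q ∩ B) + Φ (Q \ B) ≤ Φ ((⋃ n, A n) ∩ B) + Φ ((⋃ n, A n) \ B) := by
        gcongr <;> exact hA.2
    _ = Ψ ((⋃ n, A n) ∩ B) + Ψ ((⋃ n, A n) \ B) := by
        rw [heq _ (hU.inter hB), heq _ (hU.diff hB)]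
    _ = Ψ (⋃ n, A n) := ((Ψ.isCaratheodory_iff.1 (hΨcar _ hB)) _).symm
    _ = Φ (⋃ n, A n) := heq _ hU
    _ ≤ coverSum φ₀ A := iInf₂_le _ ⟨hA.1, Subset.rfl⟩

/-- The dynamically defined measure: the restriction of `Φ` to the Borel σ-algebra. -/
noncomputable def ddMeasure (φ₀ : Measure[coordAlg E 0] (ℤ → E)) [IsFiniteMeasure φ₀] :
    Measure (ℤ → E) :=
  (ddOuter φ₀).toMeasure (le_caratheodory φ₀)

theorem ddMeasure_apply (φ₀ : Measure[coordAlg E 0] (ℤ → E)) [IsFiniteMeasure φ₀]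
    {Q : Set (ℤ → E)} (hQ : MeasurableSet Q) : ddMeasure φ₀ Q = ddOuter φ₀ Q :=
  toMeasure_apply _ _ hQ

/-- The normalised measure `Φ̂ = Φ / Φ(Σ)`. -/
noncomputable def ddNormed (φ₀ : Measure[coordAlg E 0] (ℤ → E)) [IsFiniteMeasure φ₀] :
    Measure (ℤ → E) :=
  (ddMeasure φ₀ univ)⁻¹ • ddMeasure φ₀

/-- `Z` is a version of the Radon–Nikodym derivative on `𝒜_0` of (the restriction to `𝒜_0` of) `Λ`
with respect to `φ₀`. -/
def IsDensity (Λ : Measure (ℤ → E)) (φ₀ : Measure[coordAlg E 0] (ℤ → E))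
    (Z : (ℤ → E) → ℝ≥0∞) : Prop :=
  Measurable[coordAlg E 0] Z ∧ Λ.trim (coordAlg_le 0) = φ₀.withDensity Z

/-- `Z* = sup_{m ≤ 0} Z ∘ S^m`. -/
noncomputable def supDensity (Z : (ℤ → E) → ℝ≥0∞) (σ : ℤ → E) : ℝ≥0∞ :=
  ⨆ n : ℕ, Z (shift (-n) σ)

/-- The extended integral `∫ f dμ = ∫ f⁺ dμ - ∫ f⁻ dμ` of an extended real function; it is the usual
one whenever one of the two terms is finite. -/
noncomputable def extIntegral {X : Type*} [MeasurableSpace X] (μ : Measure X) (f : X → EReal) :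
    EReal :=
  ((∫⁻ x, (f x).toENNReal ∂μ : ℝ≥0∞) : EReal) - ((∫⁻ x, (-f x).toENNReal ∂μ : ℝ≥0∞) : EReal)

/-- `K*(Λ|φ₀) = ∫ log Z* dΛ`, for a version `Z` of `dΛ/dφ₀`. -/
noncomputable def Kstar (Λ : Measure (ℤ → E)) (Z : (ℤ → E) → ℝ≥0∞) : EReal :=
  extIntegral Λ fun σ => ENNReal.log (supDensity Z σ)

end Defs

end DynDefMeasure

/-! The measure `Λ / Z*` is dominated by `Φ`. If `A ∈ 𝒜_{-n}`, then `1 / Z* ≤ 1 / (Z ∘ S^{-n})`, and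
invariance of `Λ` turns the integral of the right side over `A` into `∫ 1/Z dΛ` over `S^{-n} A`,
which is at most `φ₀ (S^{-n} A)`. Summing over a cover of `Q` gives `∫_Q 1/Z* dΛ ≤ Φ(Q)`
(`setLIntegral_inv_supDensity_le_ddOuter`).

Statement (i) is then Jensen's inequality for `exp` and `-log Z*` on `Q`. For (ii), domination means
`dΛ/dΦ̂ ≤ Φ(Σ) Z*`; taking logarithms and integrating gives `K(Λ|Φ̂) ≤ log Φ(Σ) + K*`, and `Φ(Σ) ≤
1`. All logarithms are integrable: `∫ 1/Z* dΛ ≤ 1` controls the negative part, `K* < ∞` the positive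
part. -/

namespace DynDefMeasure

/-! ### Integrability of logarithms, Jensen's inequality and densities. -/

section Integrals

variable {X : Type*} [MeasurableSpace X] {μ : Measure X}

theorem extIntegral_eq_coe_integral {f : X → EReal} {g : X → ℝ} (hg : Integrable g μ)
    (hfg : ∀ᵐ x ∂μ, f x = g x) : extIntegral μ f = ((∫ x, g x ∂μ : ℝ) : EReal) := by
  have h1 : ∫⁻ x, (f x).toENNReal ∂μ = ∫⁻ x, ENNReal.ofReal (g x) ∂μ :=
    lintegral_congr_ae <| hfg.mono fun x hx => by simp [hx]
  have h2 : ∫⁻ x, (-f x).toENNReal ∂μ = ∫⁻ x, ENNReal.ofReal (-g x) ∂μ :=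
    lintegral_congr_ae <| hfg.mono fun x hx => by
      simp only [hx, ← EReal.coe_neg, EReal.real_coe_toENNReal]
  have f1 : ∫⁻ x, ENNReal.ofReal (g x) ∂μ ≠ ∞ := hg.lintegral_lt_top.ne
  have f2 : ∫⁻ x, ENNReal.ofReal (-g x) ∂μ ≠ ∞ := hg.neg.lintegral_lt_top.ne
  rw [extIntegral, h1, h2, integral_eq_lintegral_pos_part_sub_lintegral_neg_part hg,
    EReal.coe_sub, EReal.coe_ennreal_toReal f1, EReal.coe_ennreal_toReal f2]

/-- From `log t ≤ t - 1` at `t = 1/y`. This is how a finite integral of `1 / Y` controls the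
negative part of `log Y`. -/
theorem neg_log_toENNReal_le_inv (y : ℝ≥0∞) : (-ENNReal.log y).toENNReal ≤ y⁻¹ := by
  rcases eq_or_ne y 0 with rfl | h0
  · simp
  rcases eq_or_ne y ∞ with rfl | ht
  · simp
  rw [ENNReal.log_pos_real h0 ht, ← EReal.coe_neg, EReal.real_coe_toENNReal]
  have hy := ENNReal.toReal_pos h0 ht
  rw [← ENNReal.ofReal_toReal (ENNReal.inv_ne_top.2 h0), ENNReal.toReal_inv]
  refine ENNReal.ofReal_le_ofReal ?_
  rw [← Real.log_inv]
  linarith [Real.log_le_sub_one_of_pos (inv_pos.2 hy)]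

/-- If `1 / Y` and the positive part of `log Y` have finite integral, then `Y` takes values in
`(0, ∞)` almost everywhere and `log Y` is integrable. -/
theorem integrable_log_of_lintegral_inv_ne_top {Y : X → ℝ≥0∞} (hY : Measurable Y)
    (hinv : ∫⁻ x, (Y x)⁻¹ ∂μ ≠ ∞) (hlog : ∫⁻ x, (ENNReal.log (Y x)).toENNReal ∂μ ≠ ∞) :
    (∀ᵐ x ∂μ, Y x ≠ 0) ∧ (∀ᵐ x ∂μ, Y x ≠ ∞) ∧ Integrable (fun x => Real.log (Y x).toReal) μ := by
  have h0 : ∀ᵐ x ∂μ, Y x ≠ 0 :=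
    (ae_lt_top hY.inv hinv).mono fun x hx h => by simp [h] at hx
  have hml : Measurable fun x => (ENNReal.log (Y x)).toENNReal :=
    hY.ennreal_log.ereal_toENNReal
  have ht : ∀ᵐ x ∂μ, Y x ≠ ∞ :=
    (ae_lt_top hml hlog).mono fun x hx h => by simp [h] at hx
  refine ⟨h0, ht, (Real.measurable_log.comp hY.ennreal_toReal).aestronglyMeasurable, ?_⟩
  refine lt_of_le_of_lt ?_ (ENNReal.add_lt_top.2 ⟨hlog.lt_top, hinv.lt_top⟩)
  rw [← lintegral_add_left hml]
  refine lintegral_mono_ae ?_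
  filter_upwards [h0, ht] with x hx0 hxt
  have hneg := neg_log_toENNReal_le_inv (Y x)
  rw [ENNReal.log_pos_real hx0 hxt, ← EReal.coe_neg, EReal.real_coe_toENNReal] at hneg
  rw [ENNReal.log_pos_real hx0 hxt, EReal.real_coe_toENNReal, ← ofReal_norm,
    Real.norm_eq_abs]
  rcases le_total 0 (Real.log (Y x).toReal) with h | h
  · rw [abs_of_nonneg h]; exact le_self_add
  · rw [abs_of_nonpos h]; exact hneg.trans le_add_self

theorem ereal_log_eq_coe_log_toReal {Y : X → ℝ≥0∞} (h0 : ∀ᵐ x ∂μ, Y x ≠ 0)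
    (ht : ∀ᵐ x ∂μ, Y x ≠ ∞) :
    ∀ᵐ x ∂μ, ENNReal.log (Y x) = (Real.log (Y x).toReal : EReal) := by
  filter_upwards [h0, ht] with x hx0 hxt using ENNReal.log_pos_real hx0 hxt

/-- Jensen's inequality for `exp`, applied to `- log Y`. -/
theorem measure_mul_exp_neg_average_log_le [IsFiniteMeasure μ] (hμ : 0 < μ univ) {Y : X → ℝ≥0∞}
    (hY : Measurable Y) (h0 : ∀ᵐ x ∂μ, Y x ≠ 0) (ht : ∀ᵐ x ∂μ, Y x ≠ ∞)
    (hint : Integrable (fun x => Real.log (Y x).toReal) μ) (hinv : ∫⁻ x, (Y x)⁻¹ ∂μ ≠ ∞) :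
    μ univ * ENNReal.ofReal
        (Real.exp (-((μ univ).toReal⁻¹ * ∫ x, Real.log (Y x).toReal ∂μ)))
      ≤ ∫⁻ x, (Y x)⁻¹ ∂μ := by
  have : NeZero μ := ⟨fun h => by simp [h] at hμ⟩
  have hexp : (fun x => Real.exp (-Real.log (Y x).toReal)) =ᵐ[μ] fun x => ((Y x)⁻¹).toReal := by
    filter_upwards [h0, ht] with x hx0 hxt
    rw [← Real.log_inv, Real.exp_log (inv_pos.2 (ENNReal.toReal_pos hx0 hxt)), ENNReal.toReal_inv]
  have hinvint : Integrable (fun x => ((Y x)⁻¹).toReal) μ :=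
    integrable_toReal_of_lintegral_ne_top hY.inv.aemeasurable hinv
  have hJ := convexOn_exp.map_average_le (μ := μ) (f := fun x => -Real.log (Y x).toReal)
    Real.continuous_exp.continuousOn isClosed_univ (by simp) hint.neg (hinvint.congr hexp.symm)
  have hreal : ∫ x, ((Y x)⁻¹).toReal ∂μ = (∫⁻ x, (Y x)⁻¹ ∂μ).toReal :=
    integral_toReal hY.inv.aemeasurable (ae_lt_top hY.inv hinv)
  rw [average_eq, average_eq, integral_neg, integral_congr_ae hexp, hreal, smul_eq_mul, smul_eq_mul,
    mul_neg, measureReal_def] at hJ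
  have hpos : 0 < (μ univ).toReal := ENNReal.toReal_pos hμ.ne' (measure_ne_top _ _)
  rw [le_inv_mul_iff₀ hpos] at hJ
  calc _ = ENNReal.ofReal ((μ univ).toReal *
        Real.exp (-((μ univ).toReal⁻¹ * ∫ x, Real.log (Y x).toReal ∂μ))) := by
        rw [ENNReal.ofReal_mul hpos.le, ENNReal.ofReal_toReal (measure_ne_top _ _)]
    _ ≤ ENNReal.ofReal (∫⁻ x, (Y x)⁻¹ ∂μ).toReal := ENNReal.ofReal_le_ofReal hJ
    _ = _ := ENNReal.ofReal_toReal hinv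

/-- The inverse of `dμ/dν` is `dν/dμ` `μ`-almost everywhere, and the latter integrates to the mass
of the part of `ν` absolutely continuous with respect to `μ`. -/
theorem lintegral_inv_rnDeriv_le {ν : Measure X} [SigmaFinite μ] [SigmaFinite ν] (h : μ ≪ ν) :
    ∫⁻ x, (μ.rnDeriv ν x)⁻¹ ∂μ ≤ ν univ := by
  calc ∫⁻ x, (μ.rnDeriv ν x)⁻¹ ∂μ = ∫⁻ x, ν.rnDeriv μ x ∂μ :=
        lintegral_congr_ae (Measure.inv_rnDeriv h)
    _ ≤ ν univ := Measure.lintegral_rnDeriv_le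

/-- If `(1 / Y) μ ≤ ν`, then `μ ≪ ν` and `dμ/dν ≤ Y` almost everywhere. -/
theorem rnDeriv_le_of_withDensity_inv_le {ν : Measure X} [IsFiniteMeasure μ] [IsFiniteMeasure ν]
    {Y : X → ℝ≥0∞} (hY : Measurable Y) (h0 : ∀ᵐ x ∂μ, Y x ≠ 0) (ht : ∀ᵐ x ∂μ, Y x ≠ ∞)
    (h : μ.withDensity (fun x => (Y x)⁻¹) ≤ ν) :
    μ ≪ ν ∧ ∀ᵐ x ∂μ, μ.rnDeriv ν x ≤ Y x := by
  have hac : μ ≪ ν := by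
    -- The density `1 / Y` vanishes only where `Y = ∞`, a `μ`-null set, so `μ ≪ (1 / Y) μ`.
    refine (withDensity_absolutelyContinuous' hY.inv.aemeasurable ?_).trans
      (Measure.absolutelyContinuous_of_le h)
    exact ht.mono fun x hx => ENNReal.inv_ne_zero.2 hx
  refine ⟨hac, ?_⟩
  have hmul : ∀ᵐ x ∂ν, μ.rnDeriv ν x * (Y x)⁻¹ ≤ 1 := by
    refine ae_le_of_forall_setLIntegral_le_of_sigmaFinite
      ((Measure.measurable_rnDeriv _ _).mul hY.inv) fun s hs _ => ?_
    have heq := setLIntegral_withDensity_eq_setLIntegral_mul ν (Measure.measurable_rnDeriv μ ν)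
      hY.inv hs
    rw [Measure.withDensity_rnDeriv_eq _ _ hac] at heq
    have hs' := h s
    rw [withDensity_apply _ hs] at hs'
    calc ∫⁻ x in s, μ.rnDeriv ν x * (Y x)⁻¹ ∂ν = ∫⁻ x in s, (Y x)⁻¹ ∂μ := heq.symm
      _ ≤ ν s := hs'
      _ = ∫⁻ _ in s, 1 ∂ν := by simp
  filter_upwards [hac.ae_le hmul, h0, ht] with x hx hx0 hxt
  rwa [← div_eq_mul_inv, ENNReal.div_le_iff hx0 hxt, one_mul] at hx

end Integrals

/-! ### Comparison of `Λ / Z*` with `Φ`. -/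

section Shift

variable {E : Type*} [MeasurableSpace E]

theorem measurable_shift (m : ℤ) : Measurable (shift m : (ℤ → E) → ℤ → E) :=
  measurable_pi_lambda _ fun i => measurable_pi_apply (i + m)

theorem measurePreserving_shift_neg {Λ : Measure (ℤ → E)}
    (hinv : MeasurePreserving (shift 1) Λ Λ) (n : ℕ) :
    MeasurePreserving (shift (-(n : ℤ))) Λ Λ := by
  have h1 : MeasurePreserving (shift (-1)) Λ Λ := by
    refine ⟨measurable_shift _, ?_⟩
    -- Writing `Λ` as its own image under `S` lets `S⁻¹` cancel.
    conv_lhs => rw [← hinv.map_eq]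
    rw [Measure.map_map (measurable_shift _) (measurable_shift _)]
    convert Measure.map_id using 2
    funext σ
    simp [shift_shift, shift_zero]
  induction n with
  | zero =>
    convert MeasurePreserving.id Λ using 1
    funext σ
    simp [shift_zero]
  | succ n ih =>
    convert h1.comp ih using 1
    funext σ
    simp only [Function.comp, shift_shift]
    congr 1
    push_cast
    ring

theorem measurable_supDensity {Z : (ℤ → E) → ℝ≥0∞} (hZ : Measurable[coordAlg E 0] Z) :
    Measurable (supDensity Z) :=
  Measurable.iSup fun n => (hZ.mono (coordAlg_le 0) le_rfl).comp (measurable_shift (-(n : ℤ)))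

variable {φ₀ : Measure[coordAlg E 0] (ℤ → E)} {Λ : Measure (ℤ → E)} {Z : (ℤ → E) → ℝ≥0∞}

theorem setLIntegral_inv_density_le (hZ : IsDensity Λ φ₀ Z) {B : Set (ℤ → E)}
    (hB : MeasurableSet[coordAlg E 0] B) : ∫⁻ σ in B, (Z σ)⁻¹ ∂Λ ≤ φ₀ B := by
  have hZi : Measurable[coordAlg E 0] fun σ => (Z σ)⁻¹ := hZ.1.inv
  calc ∫⁻ σ in B, (Z σ)⁻¹ ∂Λ
      = @lintegral _ (coordAlg E 0) ((Λ.trim (coordAlg_le 0)).restrict B) fun σ => (Z σ)⁻¹ := by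
        rw [restrict_trim _ _ hB, lintegral_trim _ hZi]
    _ = @lintegral _ (coordAlg E 0) (φ₀.restrict B) (Z * fun σ => (Z σ)⁻¹) := by
        rw [hZ.2]
        exact setLIntegral_withDensity_eq_setLIntegral_mul φ₀ hZ.1 hZi hB
    _ ≤ @lintegral _ (coordAlg E 0) (φ₀.restrict B) fun _ => 1 :=
        -- Only an inequality: the product is `0` where `Z` is `0` or `∞`.
        lintegral_mono fun σ => ENNReal.mul_inv_le_one _
    _ = φ₀ B := by simp

theorem setLIntegral_inv_supDensity_le (hinv : MeasurePreserving (shift 1) Λ Λ)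
    (hZ : IsDensity Λ φ₀ Z) (n : ℕ) {A : Set (ℤ → E)}
    (hA : MeasurableSet[coordAlg E (-n)] A) :
    ∫⁻ σ in A, (supDensity Z σ)⁻¹ ∂Λ ≤ φ₀ (shift (-n) '' A) := by
  have hB := measurableSet_cover n hA
  have hinj : Function.Injective (shift (-(n : ℤ)) : (ℤ → E) → ℤ → E) := fun σ τ h => by
    simpa [shift_shift, shift_zero] using congrArg (shift (n : ℤ)) h
  calc ∫⁻ σ in A, (supDensity Z σ)⁻¹ ∂Λ ≤ ∫⁻ σ in A, (Z (shift (-n) σ))⁻¹ ∂Λ :=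
        lintegral_mono fun σ => ENNReal.inv_le_inv.2 (le_iSup (fun k : ℕ => Z (shift (-k) σ)) n)
    _ = ∫⁻ σ in shift (-n) ⁻¹' (shift (-n) '' A), (Z (shift (-n) σ))⁻¹ ∂Λ := by
        -- `A` is put in preimage form for the change of variables under `S^{-n}`.
        rw [preimage_image_eq _ hinj]
    _ = ∫⁻ σ in shift (-n) '' A, (Z σ)⁻¹ ∂Λ :=
        (measurePreserving_shift_neg hinv n).setLIntegral_comp_preimage (coordAlg_le 0 _ hB)
          (hZ.1.mono (coordAlg_le 0) le_rfl).inv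
    _ ≤ φ₀ (shift (-n) '' A) := setLIntegral_inv_density_le hZ hB

theorem setLIntegral_inv_supDensity_le_ddOuter (hinv : MeasurePreserving (shift 1) Λ Λ)
    (hZ : IsDensity Λ φ₀ Z) (Q : Set (ℤ → E)) :
    ∫⁻ σ in Q, (supDensity Z σ)⁻¹ ∂Λ ≤ ddOuter φ₀ Q := by
  rw [ddOuter_apply]
  refine le_iInf₂ fun A hA => ?_
  calc ∫⁻ σ in Q, (supDensity Z σ)⁻¹ ∂Λ ≤ ∫⁻ σ in ⋃ n, A n, (supDensity Z σ)⁻¹ ∂Λ :=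
        lintegral_mono_set hA.2
    _ ≤ ∑' n, ∫⁻ σ in A n, (supDensity Z σ)⁻¹ ∂Λ := lintegral_iUnion_le _ _
    _ ≤ coverSum φ₀ A :=
        ENNReal.tsum_le_tsum fun n => setLIntegral_inv_supDensity_le hinv hZ n (hA.1 n)

theorem ddOuter_univ_le_one (φ₀ : Measure[coordAlg E 0] (ℤ → E)) [IsProbabilityMeasure φ₀] :
    ddOuter φ₀ univ ≤ 1 :=
  (ddOuter_le φ₀ 0 (@MeasurableSet.univ _ (coordAlg E _))).trans prob_le_one

theorem lintegral_inv_supDensity_ne_top [IsProbabilityMeasure φ₀]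
    (hinv : MeasurePreserving (shift 1) Λ Λ) (hZ : IsDensity Λ φ₀ Z) :
    ∫⁻ σ, (supDensity Z σ)⁻¹ ∂Λ ≠ ∞ := by
  have h := setLIntegral_inv_supDensity_le_ddOuter hinv hZ univ
  rw [Measure.restrict_univ] at h
  exact ne_top_of_le_ne_top ENNReal.one_ne_top (h.trans (ddOuter_univ_le_one φ₀))

/-- The negative part of `log Z*` has finite integral, so an infinite positive part would force `K*
= ⊤`. -/
theorem lintegral_log_supDensity_ne_top [IsProbabilityMeasure φ₀]
    (hinv : MeasurePreserving (shift 1) Λ Λ) (hZ : IsDensity Λ φ₀ Z) (hK : Kstar Λ Z < ⊤) :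
    ∫⁻ σ, (ENNReal.log (supDensity Z σ)).toENNReal ∂Λ ≠ ∞ := by
  intro h
  have hneg : ∫⁻ σ, (-ENNReal.log (supDensity Z σ)).toENNReal ∂Λ ≠ ∞ :=
    ne_top_of_le_ne_top (lintegral_inv_supDensity_ne_top hinv hZ)
      (lintegral_mono fun σ => neg_log_toENNReal_le_inv _)
  refine hK.ne ?_
  rw [Kstar, extIntegral, h, ← EReal.coe_ennreal_toReal hneg, EReal.coe_ennreal_top,
    EReal.top_sub_coe]

theorem withDensity_inv_supDensity_le_ddMeasure [IsProbabilityMeasure φ₀]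
    (hinv : MeasurePreserving (shift 1) Λ Λ) (hZ : IsDensity Λ φ₀ Z) :
    Λ.withDensity (fun σ => (supDensity Z σ)⁻¹) ≤ ddMeasure φ₀ := by
  refine Measure.le_iff.2 fun s hs => ?_
  rw [withDensity_apply _ hs, ddMeasure_apply φ₀ hs]
  exact setLIntegral_inv_supDensity_le_ddOuter hinv hZ s

end Shift

/-! ### The divergence bound. -/

theorem klDiv_ddNormed_le {E : Type*} [MeasurableSpace E]
    {φ₀ : Measure[coordAlg E 0] (ℤ → E)} [IsProbabilityMeasure φ₀]
    {Λ : Measure (ℤ → E)} [IsProbabilityMeasure Λ] {Z : (ℤ → E) → ℝ≥0∞}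
    (hinv : MeasurePreserving (shift 1) Λ Λ) (hZ : IsDensity Λ φ₀ Z) (hK : Kstar Λ Z < ⊤)
    (hpos : 0 < ddOuter φ₀ univ) :
    (InformationTheory.klDiv Λ (ddNormed φ₀) : EReal)
      ≤ ((Real.log (ddOuter φ₀ univ).toReal
          + ∫ σ, Real.log (supDensity Z σ).toReal ∂Λ : ℝ) : EReal) := by
  obtain ⟨h0, ht, hint⟩ := integrable_log_of_lintegral_inv_ne_top (measurable_supDensity hZ.1)
    (lintegral_inv_supDensity_ne_top hinv hZ) (lintegral_log_supDensity_ne_top hinv hZ hK)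
  set a := ddOuter φ₀ univ with ha
  have ha1 : a ≤ 1 := ddOuter_univ_le_one φ₀
  have hat : a ≠ ∞ := ne_top_of_le_ne_top ENNReal.one_ne_top ha1
  have haM : ddMeasure φ₀ univ = a := ddMeasure_apply φ₀ MeasurableSet.univ
  have huniv : ddNormed φ₀ univ = 1 := by
    rw [ddNormed, Measure.smul_apply, haM, smul_eq_mul, ENNReal.inv_mul_cancel hpos.ne' hat]
  have : IsProbabilityMeasure (ddNormed φ₀) := ⟨huniv⟩
  have hmY : Measurable fun σ => a * supDensity Z σ := (measurable_supDensity hZ.1).const_mul a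
  -- Dividing `Φ` by its mass `a` replaces `Z*` by `a Z*` in the domination.
  have hle : Λ.withDensity (fun σ => (a * supDensity Z σ)⁻¹) ≤ ddNormed φ₀ := by
    refine Measure.le_iff.2 fun s hs => ?_
    have h := withDensity_inv_supDensity_le_ddMeasure hinv hZ s
    rw [withDensity_apply _ hs] at h ⊢
    rw [ddNormed, Measure.smul_apply, haM, smul_eq_mul]
    simp_rw [ENNReal.mul_inv (Or.inl hpos.ne') (Or.inl hat)]
    rw [lintegral_const_mul' _ _ (ENNReal.inv_ne_top.2 hpos.ne')]
    gcongr
  obtain ⟨hac, hX⟩ := rnDeriv_le_of_withDensity_inv_le hmY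
    (h0.mono fun σ hσ => mul_ne_zero hpos.ne' hσ)
    (ht.mono fun σ hσ => ENNReal.mul_ne_top hat hσ) hle
  -- Since `a ≤ 1`, the density is at most `Z*` and inherits its bound on the positive part of the
  -- logarithm.
  have hlogX : ∫⁻ σ, (ENNReal.log (Λ.rnDeriv (ddNormed φ₀) σ)).toENNReal ∂Λ ≠ ∞ := by
    refine ne_top_of_le_ne_top (lintegral_log_supDensity_ne_top hinv hZ hK)
      (lintegral_mono_ae (hX.mono fun σ hσ => ?_))
    exact EReal.toENNReal_le_toENNReal
      (ENNReal.log_monotone (hσ.trans (mul_le_of_le_one_left' ha1)))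
  obtain ⟨hX0, hXt, hXint⟩ := integrable_log_of_lintegral_inv_ne_top
    (Measure.measurable_rnDeriv Λ (ddNormed φ₀))
    (ne_top_of_le_ne_top (measure_ne_top _ _) (lintegral_inv_rnDeriv_le hac)) hlogX
  -- Both masses are `1`, so the mass correction in `klDiv` vanishes.
  have hkl := InformationTheory.toReal_klDiv_of_measure_eq hac (by simp)
  rw [← EReal.coe_ennreal_toReal (InformationTheory.klDiv_ne_top hac hXint), hkl,
    EReal.coe_le_coe_iff]
  calc ∫ σ, llr Λ (ddNormed φ₀) σ ∂Λ
      ≤ ∫ σ, (Real.log a.toReal + Real.log (supDensity Z σ).toReal) ∂Λ := by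
        refine integral_mono_ae hXint ((integrable_const _).add hint) ?_
        filter_upwards [hX, hX0, hXt, h0, ht] with σ h hσ0 hσt hz0 hzt
        have hp : 0 < (Λ.rnDeriv (ddNormed φ₀) σ).toReal := ENNReal.toReal_pos hσ0 hσt
        calc Real.log (Λ.rnDeriv (ddNormed φ₀) σ).toReal
            ≤ Real.log (a * supDensity Z σ).toReal :=
              Real.log_le_log hp (ENNReal.toReal_mono (ENNReal.mul_ne_top hat hzt) h)
          _ = _ := by
              rw [ENNReal.toReal_mul, Real.log_mul (ENNReal.toReal_pos hpos.ne' hat).ne'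
                (ENNReal.toReal_pos hz0 hzt).ne']
    _ = _ := by
        rw [integral_add (integrable_const _) hint]
        simp

end DynDefMeasure

/-! ### Deduction of (i) and (ii). -/

theorem mainTheorem1 {E : Type*} [Finite E] [TopologicalSpace E] [DiscreteTopology E]
    [MeasurableSpace E] [BorelSpace E]
    (φ₀ : Measure[DynDefMeasure.coordAlg E 0] (ℤ → E)) [IsProbabilityMeasure φ₀]
    (Λ : Measure (ℤ → E)) [IsProbabilityMeasure Λ]
    (hinv : MeasurePreserving (DynDefMeasure.shift 1) Λ Λ)
    (hac : Λ.trim (DynDefMeasure.coordAlg_le 0) ≪ φ₀)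
    (Z : (ℤ → E) → ℝ≥0∞) (hZ : DynDefMeasure.IsDensity Λ φ₀ Z)
    (hK : DynDefMeasure.Kstar Λ Z < ⊤) :
    (∀ Q : Set (ℤ → E), MeasurableSet Q → 0 < Λ Q →
      Λ Q * EReal.exp (-(1 / (Λ Q : EReal) *
          DynDefMeasure.extIntegral (Λ.restrict Q)
            (fun σ => ENNReal.log (DynDefMeasure.supDensity Z σ))))
        ≤ DynDefMeasure.ddOuter φ₀ Q) ∧
    0 < DynDefMeasure.ddOuter φ₀ univ ∧
    EReal.exp ((InformationTheory.klDiv Λ (DynDefMeasure.ddNormed φ₀) : EReal)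
        - DynDefMeasure.Kstar Λ Z)
      ≤ DynDefMeasure.ddOuter φ₀ univ ∧
    (InformationTheory.klDiv Λ (DynDefMeasure.ddNormed φ₀) : EReal)
      ≤ DynDefMeasure.Kstar Λ Z := by
  obtain ⟨h0, ht, hint⟩ := DynDefMeasure.integrable_log_of_lintegral_inv_ne_top
    (DynDefMeasure.measurable_supDensity hZ.1)
    (DynDefMeasure.lintegral_inv_supDensity_ne_top hinv hZ)
    (DynDefMeasure.lintegral_log_supDensity_ne_top hinv hZ hK)
  have hKeq : DynDefMeasure.Kstar Λ Z
      = ((∫ σ, Real.log (DynDefMeasure.supDensity Z σ).toReal ∂Λ : ℝ) : EReal) :=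
    DynDefMeasure.extIntegral_eq_coe_integral hint
      (DynDefMeasure.ereal_log_eq_coe_log_toReal h0 ht)
  have hi : ∀ Q : Set (ℤ → E), MeasurableSet Q → 0 < Λ Q →
      Λ Q * EReal.exp (-(1 / (Λ Q : EReal) *
          DynDefMeasure.extIntegral (Λ.restrict Q)
            (fun σ => ENNReal.log (DynDefMeasure.supDensity Z σ))))
        ≤ DynDefMeasure.ddOuter φ₀ Q := by
    intro Q _ hQ
    have hne := ne_top_of_le_ne_top (DynDefMeasure.lintegral_inv_supDensity_ne_top hinv hZ)
      (setLIntegral_le_lintegral Q _)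
    have h0Q := ae_restrict_of_ae (s := Q) h0
    have htQ := ae_restrict_of_ae (s := Q) ht
    have hJ := DynDefMeasure.measure_mul_exp_neg_average_log_le (μ := Λ.restrict Q) (by simpa)
      (DynDefMeasure.measurable_supDensity hZ.1) h0Q htQ hint.restrict hne
    rw [Measure.restrict_apply_univ] at hJ
    rw [DynDefMeasure.extIntegral_eq_coe_integral hint.restrict
        (DynDefMeasure.ereal_log_eq_coe_log_toReal h0Q htQ),
      ← EReal.coe_ennreal_toReal (measure_ne_top Λ Q), one_div, ← EReal.coe_inv, ← EReal.coe_mul,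
      ← EReal.coe_neg, EReal.exp_coe]
    exact hJ.trans (DynDefMeasure.setLIntegral_inv_supDensity_le_ddOuter hinv hZ Q)
  -- Case `Q = Σ` of (i): the lower bound is `exp (-K*)` with `K*` real.
  have hpos : 0 < DynDefMeasure.ddOuter φ₀ univ := by
    refine lt_of_lt_of_le ?_ (hi univ MeasurableSet.univ (by simp))
    have h := hKeq
    rw [DynDefMeasure.Kstar] at h
    rw [Measure.restrict_univ, measure_univ, h, one_mul, EReal.coe_ennreal_one, one_div, inv_one,
      one_mul, ← EReal.coe_neg, EReal.exp_coe]
    exact ENNReal.ofReal_pos.2 (Real.exp_pos _)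
  have ha1 := DynDefMeasure.ddOuter_univ_le_one φ₀
  have hat := ne_top_of_le_ne_top ENNReal.one_ne_top ha1
  have hapos := ENNReal.toReal_pos hpos.ne' hat
  have hkl := DynDefMeasure.klDiv_ddNormed_le hinv hZ hK hpos
  refine ⟨hi, hpos, ?_, ?_⟩
  · rw [hKeq]
    refine (EReal.exp_monotone (EReal.sub_le_of_le_add (hkl.trans_eq (EReal.coe_add _ _)))).trans ?_
    rw [EReal.exp_coe, Real.exp_log hapos, ENNReal.ofReal_toReal hat]
  · rw [hKeq]
    refine hkl.trans (EReal.coe_le_coe_iff.2 ?_)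
    have : Real.log (DynDefMeasure.ddOuter φ₀ univ).toReal ≤ 0 :=
      Real.log_nonpos hapos.le (by simpa using ENNReal.toReal_mono ENNReal.one_ne_top ha1)
    linarith
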